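/- Let $\mathbb{F}_q$ be a finite field with a fixed primitive element $\alpha$, let $\mathcal{C}\subseteq\mathbb{F}_q^n$ be a linear code, and let $\mathbb{K}$ be an arbitrary field. Let $\mathbb{K}[\mathbf{x}]$ be the polynomial ring in the variables $x_{ij}$, $1\le i\le n$, $1\le j\le q-1$. The crossing map $\blacktriangle\colon\mathbb{F}_q^n\to\mathbb{N}_0^{n(q-1)}$ replaces each coordinate $\alpha^j$ ($1\le j\le q-1$) by the $j$th unit vector of length $q-1$ and each zero coordinate by the zero vector. Let $I=I_+(\mathcal{C})=\langle \mathbf{x}^{\blacktriangle a}-\mathbf{x}^{\blacktriangle b}\mid a,b\in\mathbb{F}_q^n,\ a-b\in\mathcal{C}\rangle$ be the generalized code ideal. (The statement is asserted also for $I=I_+(\mathcal{C})+I_q$, where $I_q$ is generated by all $x_{iu}x_{iv}-x_{iw}$ with $\alpha^u+\alpha^v=\alpha^w$ and all $x_{iu}x_{iv}-1$ with $\alpha^u+\alpha^v=0$.) A pure binomial of $I$ is a polynomial $\mathbf{x}^u-\mathbf{x}^{u'}\in I$ with $u\ne u'$ whose two monomials are relatively prime. It is primitive if there is no other pure binomial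 $\mathbf{x}^{v}-\mathbf{x}^{v'}\in I$ (that is, with $(v,v')\neq(u,u')$) such that $\mathbf{x}^v$ divides $\mathbf{x}^u$ and $\mathbf{x}^{v'}$ divides $\mathbf{x}^{u'}$. The universal Gröbner basis of $I$ is the union of the reduced Gröbner bases $\mathcal{G}_\succ(I)$ over all monomial orders $\succ$. Fix a monomial order $\succ$. For $\omega\in\mathbb{R}_{\ge 0}^{n(q-1)}$ let $\succ_\omega$ be the monomial order which compares exponents first by their $\omega$-degree and breaks ties by $\succ$, let $\mathcal{G}_\omega(I)=\mathcal{G}_{\succ_\omega}(I)$, and let $$C[u,u']=\{\omega\in\mathbb{R}_{\ge 0}^{n(q-1)}\mid \omega\cdot u>\omega\cdot u'\ \text{ and }\ \mathbf{x}^u-\mathbf{x}^{u'}\in\mathcal{G}_\omega(I)\}.$$ Let $\mathbf{x}^u-\mathbf{x}^{u'}$ be a primitive binomial of $I$, and assume that $u\neq\mathbf{0}$ or that $\mathbb{K}$ has characteristic different from $2$. Then $\mathbf{x}^u-\mathbf{x}^{u'}$ belongs to the universal Gröbner basis of $I$ if and only if $C[u,u']\neq\emptyset$. This holds for every choice of the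 tie-breaking order $\succ$. -/

import Mathlib

open MvPolynomial
open scoped NNReal

noncomputable section

namespace CodeIdeal

/-! ### Weighted monomial orders -/

section Weighted

variable {σ : Type*} [Fintype σ]

/-- The inner product `ω · u` of a non-negative weight vector and an exponent vector. -/
def weight (ω : σ → ℝ≥0) (u : σ →₀ ℕ) : ℝ≥0 := ∑ i, ω i * (u i : ℝ≥0)

/-- `u ↦ (ω · u, u)`, with values in the lexicographic product of `ℝ≥0` and the order `m`. -/
def weightedHom (m : MonomialOrder σ) (ω : σ → ℝ≥0) : (σ →₀ ℕ) →+ Lex (ℝ≥0 × m.syn) where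
  toFun u := toLex (weight ω u, m.toSyn u)
  map_zero' := by
    simp only [weight, Finsupp.coe_zero, Pi.zero_apply, Nat.cast_zero, mul_zero,
      Finset.sum_const_zero, map_zero]
    rfl
  map_add' u v := by
    have h : weight ω (u + v) = weight ω u + weight ω v := by
      simp [weight, mul_add, Finset.sum_add_distrib]
    rw [h, map_add]
    rfl

theorem weightedHom_injective (m : MonomialOrder σ) (ω : σ → ℝ≥0) :
    Function.Injective (weightedHom m ω) := fun _ _ h =>
  m.toSyn.injective (congrArg (fun z => (ofLex z).2) h)

theorem weightedHom_monotone (m : MonomialOrder σ) (ω : σ → ℝ≥0) :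
    Monotone (weightedHom m ω) := by
  intro u v h
  apply Prod.Lex.toLex_mono
  refine ⟨?_, m.toSyn_monotone h⟩
  refine Finset.sum_le_sum fun i _ => ?_
  have : (u i : ℝ≥0) ≤ v i := by exact_mod_cast h i
  gcongr

/-- The order `≻_ω`: monomials are compared by their `ω`-degree first, and ties are broken
by the monomial order `m`. See `weightedOrder_lt_iff`. -/
def weightedOrder (m : MonomialOrder σ) (ω : σ → ℝ≥0) : MonomialOrder σ where
  syn := AddMonoidHom.mrange (weightedHom m ω)
  addCommMonoidSyn := inferInstance
  linearOrderSyn := inferInstance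
  isOrderedAddMonoid_syn := inferInstance
  toSyn := 
    { Equiv.ofBijective (weightedHom m ω).mrangeRestrict
        ⟨fun _ _ h => weightedHom_injective m ω (congrArg Subtype.val h),
          (weightedHom m ω).mrangeRestrict_surjective⟩ with
      map_add' := fun a b => Subtype.ext ((weightedHom m ω).map_add a b) }
  toSyn_monotone := fun _ _ h => weightedHom_monotone m ω h
  wellFoundedLT_syn := by
    have hmono : Monotone (weightedHom m ω).mrangeRestrict :=
      fun _ _ h => weightedHom_monotone m ω h
    have := hmono.wellQuasiOrderedLE_of_wellQuasiOrderedLE_of_surjective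
      (weightedHom m ω).mrangeRestrict_surjective
    infer_instance

theorem weightedOrder_lt_iff (m : MonomialOrder σ) (ω : σ → ℝ≥0) (a b : σ →₀ ℕ) :
    (weightedOrder m ω).toSyn b < (weightedOrder m ω).toSyn a ↔
      weight ω b < weight ω a ∨ (weight ω a = weight ω b ∧ m.toSyn b < m.toSyn a) := by
  change toLex (weight ω b, m.toSyn b) < toLex (weight ω a, m.toSyn a) ↔ _
  rw [Prod.Lex.toLex_lt_toLex, eq_comm (a := weight ω a)]

end Weighted

/-! ### Reduced Gröbner bases, universal Gröbner basis, primitive binomials -/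

section Groebner

variable {σ : Type*} {K : Type*} [Field K]

/-- `G` is a reduced Gröbner basis of `I` for the monomial order `m`. -/
structure IsReducedGroebnerBasis (m : MonomialOrder σ) (I : Ideal (MvPolynomial σ K))
    (G : Set (MvPolynomial σ K)) : Prop where
  finite : G.Finite
  subset : G ⊆ I
  span_leadingTerm : Ideal.span (m.leadingTerm '' G) =
    Ideal.span (m.leadingTerm '' (I : Set (MvPolynomial σ K)))
  monic : ∀ g ∈ G, m.Monic g
  reduced : ∀ g ∈ G, ∀ h ∈ G, h ≠ g → ∀ d ∈ g.support, ¬ m.degree h ≤ d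

/-- The set of elements of the (unique) reduced Gröbner basis of `I` for `m`. -/
def reducedGroebnerBasis (m : MonomialOrder σ) (I : Ideal (MvPolynomial σ K)) :
    Set (MvPolynomial σ K) :=
  {f | ∃ G, IsReducedGroebnerBasis m I G ∧ f ∈ G}

/-- The universal Gröbner basis: the union of the reduced Gröbner bases for all monomial orders.
(Every monomial order on `σ →₀ ℕ` is realized on a type `syn` in the universe of `σ`.) -/
def universalGroebnerBasis {σ : Type} (I : Ideal (MvPolynomial σ K)) :
    Set (MvPolynomial σ K) :=
  ⋃ m : MonomialOrder.{0, 0} σ, reducedGroebnerBasis m I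

/-- The difference of monomials `x ^ u - x ^ v`. -/
def binom (K : Type*) [Field K] (u v : σ →₀ ℕ) : MvPolynomial σ K :=
  monomial u 1 - monomial v 1

/-- `x ^ u - x ^ v` is a pure binomial of `I`: it lies in `I`, its two monomials are distinct
and relatively prime. -/
def IsPureBinomial (I : Ideal (MvPolynomial σ K)) (u v : σ →₀ ℕ) : Prop :=
  binom K u v ∈ I ∧ u ≠ v ∧ Disjoint u.support v.support

/-- `x ^ u - x ^ v` is a primitive binomial of `I`. -/
def IsPrimitive (I : Ideal (MvPolynomial σ K)) (u v : σ →₀ ℕ) : Prop :=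
  IsPureBinomial I u v ∧
    ∀ u' v' : σ →₀ ℕ, IsPureBinomial I u' v' → u' ≤ u → v' ≤ v → u' = u ∧ v' = v

/-- The cone `C[u,u']` of `I`, with ties broken by the monomial order `m`. -/
def cone [Fintype σ] (m : MonomialOrder σ) (I : Ideal (MvPolynomial σ K)) (u u' : σ →₀ ℕ) :
    Set (σ → ℝ≥0) :=
  {ω | weight ω u' < weight ω u ∧ binom K u u' ∈ reducedGroebnerBasis (weightedOrder m ω) I}

end Groebner

/-! ### The generalized code ideal -/

section Code

variable {F : Type*} [Field F] [Fintype F] {n : ℕ}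

/-- Indices of the variables `x i j`, `1 ≤ i ≤ n`, `1 ≤ j ≤ q - 1`; the element `j : Fin (q - 1)`
stands for the index `j + 1`. -/
abbrev Var (F : Type*) [Fintype F] (n : ℕ) : Type := Fin n × Fin (Fintype.card F - 1)

open Classical in
/-- The crossing map: for a generator `α` of the unit group, a coordinate `a i = α ^ j`
(`1 ≤ j ≤ q - 1`) becomes the `j`-th unit vector, and a zero coordinate the zero vector. -/
def crossing (α : F) (a : Fin n → F) : Var F n →₀ ℕ :=
  Finsupp.equivFunOnFinite.symm fun ij => if a ij.1 = α ^ ((ij.2 : ℕ) + 1) then 1 else 0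

/-- The ideal generated by the `x ^ ▲a - x ^ ▲b` with `a - b` in the code `C`. -/
def codeIdeal (K : Type*) [Field K] (α : F) (C : Submodule F (Fin n → F)) :
    Ideal (MvPolynomial (Var F n) K) :=
  Ideal.span {f | ∃ a b : Fin n → F, a - b ∈ C ∧ f = binom K (crossing α a) (crossing α b)}

/-- The ideal `I_q` that encodes the additive structure of `F`: it is generated by the
`x i u * x i v - x i w` with `α ^ u + α ^ v = α ^ w` and the `x i u * x i v - 1` with
`α ^ u + α ^ v = 0`. -/
def additiveIdeal (K : Type*) [Field K] (n : ℕ) (α : F) : Ideal (MvPolynomial (Var F n) K) :=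
  Ideal.span
    ({f | ∃ (i : Fin n) (u v w : Fin (Fintype.card F - 1)),
        α ^ ((u : ℕ) + 1) + α ^ ((v : ℕ) + 1) = α ^ ((w : ℕ) + 1) ∧
          f = X (i, u) * X (i, v) - X (i, w)} ∪
      {f | ∃ (i : Fin n) (u v : Fin (Fintype.card F - 1)),
        α ^ ((u : ℕ) + 1) + α ^ ((v : ℕ) + 1) = 0 ∧ f = X (i, u) * X (i, v) - 1})

end Code

end CodeIdeal

end

/-! A weight in the cone gives the monomial order `weightedOrder m ω`, so one direction is
immediate. For the converse, suppose the binomial lies in the reduced Gröbner basis of some order.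
Since `I` is generated by differences of monomials, its initial ideal is determined by the
congruence on exponents modulo `I`: a binomial `x^a - x^b` of `I` with leading exponent `a` is in
the reduced basis exactly when `a` is minimal nonstandard and `b` is standard.

Every variable of a pure binomial of `I` is invertible modulo `I` (`exists_mul_sub_one_mem`).
Cancelling a shared variable therefore shows that every other exponent of the fibre meeting the
support of `a` is larger than `a`, while `b` is least in the fibre. By Dickson's lemma these are
finitely many inequalities, and a separation argument realizes them by a positive weight
(`exists_isSeparating`). As they are strict, ties never matter, and the weight lies in the cone for
every tie-breaking order (`IsSeparating.mem_cone`).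

If the given order has `u'` as leading exponent, monicity forces characteristic 2, hence `u ≠ 0`.
Shrinking the weights of the variables of `x^u'` then makes `u` the heavier exponent
(`IsSeparating.exists_swap`). -/

namespace CodeIdeal

/-! ### Realizing finitely many order relations by a weight -/

section WeightExistence

/-- A rational affine dependency: if `0` is a convex combination of integral vectors, then it is a
non-trivial combination of them with natural coefficients. -/
theorem exists_nat_combination {σ : Type} [Fintype σ] (P : Set ((σ →₀ ℕ) × (σ →₀ ℕ)))
    (h : (0 : σ → ℝ) ∈ convexHull ℝ
      ((fun p : (σ →₀ ℕ) × (σ →₀ ℕ) => fun i => ((p.2 i : ℝ) - p.1 i)) '' P)) :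
    ∃ (ι : Type) (_ : Fintype ι) (_ : Nonempty ι) (p : ι → (σ →₀ ℕ) × (σ →₀ ℕ)) (k : ι → ℕ),
      (∀ j, p j ∈ P) ∧ (∀ j, 0 < k j) ∧ ∑ j, k j • (p j).1 = ∑ j, k j • (p j).2 := by
  obtain ⟨ι, _, z, w, hz, hind, hw, hw1, hw0⟩ := eq_pos_convex_span_of_mem_convexHull h
  have hz' : ∀ j, ∃ p ∈ P, (fun i => ((p.2 i : ℝ) - p.1 i)) = z j := fun j => hz ⟨j, rfl⟩
  choose p hp hpz using hz'
  -- A `ℚ`-linear retraction `ℝ → ℚ` turns the real relation with integral vectors into a rational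
  -- one.
  obtain ⟨φ, hφ⟩ := (Algebra.linearMap ℚ ℝ).exists_leftInverse_of_injective
    (LinearMap.ker_eq_bot.2 (algebraMap ℚ ℝ).injective)
  have hφ1 : φ 1 = 1 := by simpa using LinearMap.congr_fun hφ 1
  have hmul : ∀ (x : ℝ) (a b : ℕ), φ (x * ((a : ℝ) - b)) = φ x * ((a : ℚ) - b) := by
    intro x a b
    have : x * ((a : ℝ) - b) = a • x - b • x := by simp only [nsmul_eq_mul]; ring
    rw [this, map_sub, map_nsmul, map_nsmul]
    simp only [nsmul_eq_mul]; ring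
  have hrel : ∀ i, ∑ j, φ (w j) * (((p j).2 i : ℚ) - (p j).1 i) = 0 := by
    intro i
    have := congrArg φ (congrFun hw0 i)
    simpa [Finset.sum_apply, ← hpz, hmul] using this
  -- Carathéodory made the points affinely independent, so convex coefficients are unique. Hence the
  -- `w j` were already rational, and `φ` keeps them positive.
  have hrat : ∀ j, ((φ (w j) : ℚ) : ℝ) = w j := by
    have key := (affineIndependent_iff (k := ℝ)).1 hind Finset.univ
      (fun j => ((φ (w j) : ℚ) : ℝ) - w j) ?_ ?_
    · exact fun j => sub_eq_zero.1 (key j (Finset.mem_univ j))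
    · have : ∑ j, φ (w j) = 1 := by rw [← map_sum, hw1, hφ1]
      rw [Finset.sum_sub_distrib, hw1, ← Rat.cast_sum, this]
      simp
    · simp only [sub_smul, Finset.sum_sub_distrib, hw0, sub_zero]
      funext i
      have := congrArg (fun q : ℚ => (q : ℝ)) (hrel i)
      push_cast at this
      simpa [Finset.sum_apply, ← hpz] using this
  have hpos : ∀ j, 0 < φ (w j) := fun j => by
    have := hw j
    rw [← hrat j] at this
    exact_mod_cast this
  have hden : ∀ j, ∃ k : ℕ, (k : ℚ) = (∏ l, (φ (w l)).den : ℕ) * φ (w j) := by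
    intro j
    obtain ⟨c, hc⟩ := Finset.dvd_prod_of_mem (fun l => (φ (w l)).den) (Finset.mem_univ j)
    refine ⟨c * (φ (w j)).num.toNat, ?_⟩
    rw [hc]
    have h1 : (((φ (w j)).num.toNat : ℕ) : ℚ) = (φ (w j)).num := by
      exact_mod_cast Int.toNat_of_nonneg (Rat.num_pos.2 (hpos j)).le
    have h2 := Rat.mul_den_eq_num (φ (w j))
    push_cast
    rw [h1, ← h2]
    ring
  choose k hk using hden
  have hN : (0 : ℚ) < (∏ l, (φ (w l)).den : ℕ) := by
    exact_mod_cast Finset.prod_pos fun l _ => (φ (w l)).den_pos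
  have hι : Nonempty ι := by
    by_contra hne
    rw [not_nonempty_iff] at hne
    simp at hw1
  refine ⟨ι, inferInstance, hι, p, k, hp, fun j => ?_, ?_⟩
  · have := mul_pos hN (hpos j)
    rw [← hk] at this
    exact_mod_cast this
  · ext i
    have : ∑ j, (k j : ℚ) * (((p j).2 i : ℚ) - (p j).1 i) = 0 := by
      simp only [hk, mul_assoc, ← Finset.mul_sum, hrel, mul_zero]
    simp only [mul_sub, Finset.sum_sub_distrib, sub_eq_zero] at this
    simp only [Finsupp.finsetSum_apply, Finsupp.smul_apply, smul_eq_mul]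
    exact_mod_cast this.symm

/-- Finitely many strict inequalities of a monomial order are realized by a weight vector. -/
theorem exists_weight_of_finite {σ : Type} [Fintype σ] (m : MonomialOrder σ)
    (P : Set ((σ →₀ ℕ) × (σ →₀ ℕ))) (hfin : P.Finite)
    (hP : ∀ p ∈ P, m.toSyn p.1 < m.toSyn p.2) :
    ∃ ω : σ → ℝ≥0, (∀ i, 0 < ω i) ∧ ∀ p ∈ P, weight ω p.1 < weight ω p.2 := by
  classical
  -- The extra pairs `(0, e_i)` force the separating functional to have positive coordinates.
  let Q : Set ((σ →₀ ℕ) × (σ →₀ ℕ)) := P ∪ Set.range fun i => (0, Finsupp.single i 1)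
  have hQfin : Q.Finite := hfin.union (Set.finite_range _)
  have hQ : ∀ p ∈ Q, m.toSyn p.1 < m.toSyn p.2 := by
    rintro p (hp | ⟨i, rfl⟩)
    · exact hP p hp
    · exact m.toSyn_strictMono (pos_iff_ne_zero.2 (by simp))
  let f : (σ →₀ ℕ) × (σ →₀ ℕ) → σ → ℝ := fun p i => (p.2 i : ℝ) - p.1 i
  have h0 : (0 : σ → ℝ) ∉ convexHull ℝ (f '' Q) := by
    intro h0
    obtain ⟨ι, _, _, p, k, hp, hk, he⟩ := exists_nat_combination Q h0
    have hlt : ∑ j, k j • m.toSyn (p j).1 < ∑ j, k j • m.toSyn (p j).2 :=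
      Finset.sum_lt_sum_of_nonempty Finset.univ_nonempty fun j _ =>
        nsmul_lt_nsmul_right (hk j).ne' (hQ _ (hp j))
    have := congrArg m.toSyn he
    simp only [map_sum, map_nsmul] at this
    exact hlt.ne this
  obtain ⟨g, c, hg0, hg⟩ := geometric_hahn_banach_point_closed (E := σ → ℝ) (convex_convexHull ℝ _)
    ((hQfin.image f).isCompact_convexHull ℝ).isClosed h0
  have hgpos : ∀ p ∈ Q, 0 < g (f p) := fun p hp => by
    rw [map_zero] at hg0
    exact hg0.trans (hg _ (subset_convexHull ℝ _ ⟨p, hp, rfl⟩))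
  have hgsum : ∀ x : σ → ℝ, g x = ∑ i, g (Pi.single i 1) * x i := by
    intro x
    conv_lhs => rw [pi_eq_sum_univ' x, map_sum]
    refine Finset.sum_congr rfl fun i _ => ?_
    rw [map_smul, smul_eq_mul, mul_comm]
  have hω : ∀ i, 0 < g (Pi.single i 1) := by
    intro i
    have := hgpos _ (Or.inr ⟨i, rfl⟩)
    convert this using 2
    funext j
    simp [f, Pi.single_apply, Finsupp.single_apply, eq_comm]
  refine ⟨fun i => ⟨g (Pi.single i 1), (hω i).le⟩, fun i => hω i, fun p hp => ?_⟩
  have := hgpos p (Or.inl hp)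
  rw [hgsum] at this
  simp only [f, mul_sub, Finset.sum_sub_distrib, sub_pos] at this
  rw [← NNReal.coe_lt_coe]
  push_cast [weight]
  exact this

/-- The minimal elements of a set of exponent vectors. -/
theorem finite_minimal {σ : Type*} [Finite σ] (S : Set (σ →₀ ℕ)) :
    {v | Minimal (· ∈ S) v}.Finite :=
  (setOfPred_minimal_antichain _).finite_of_partiallyWellOrderedOn
    (Set.isPWO_of_wellQuasiOrderedLE _)

theorem exists_minimal_le {σ : Type*} [Finite σ] (S : Set (σ →₀ ℕ)) {v : σ →₀ ℕ} (hv : v ∈ S) :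
    ∃ w ≤ v, Minimal (· ∈ S) w :=
  exists_minimal_le_of_wellFoundedLT (· ∈ S) v hv

theorem weight_mono {σ : Type*} [Fintype σ] (ω : σ → ℝ≥0) {a b : σ →₀ ℕ} (h : a ≤ b) :
    weight ω a ≤ weight ω b := by
  refine Finset.sum_le_sum fun i _ => ?_
  have : (a i : ℝ≥0) ≤ b i := by exact_mod_cast h i
  gcongr

theorem weight_add {σ : Type*} [Fintype σ] (ω : σ → ℝ≥0) (a b : σ →₀ ℕ) :
    weight ω (a + b) = weight ω a + weight ω b := by
  simp [weight, mul_add, Finset.sum_add_distrib]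

theorem weight_pos {σ : Type*} [Fintype σ] {ω : σ → ℝ≥0} (hω : ∀ i, 0 < ω i) {a : σ →₀ ℕ}
    (ha : a ≠ 0) : 0 < weight ω a := by
  obtain ⟨i, hi⟩ := Finsupp.ne_iff.1 ha
  refine Finset.sum_pos' (fun _ _ => zero_le) ⟨i, Finset.mem_univ i, ?_⟩
  exact mul_pos (hω i) (by exact_mod_cast Nat.pos_of_ne_zero hi)

end WeightExistence

end CodeIdeal

noncomputable section

namespace CodeIdeal

/-! ### Reduced Gröbner bases of binomial ideals -/

section BinomialIdeal

variable {σ : Type*} {K : Type*} [Field K]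

/-- `I` is generated by differences of monomials. -/
def IsBinomialIdeal (I : Ideal (MvPolynomial σ K)) : Prop :=
  ∃ B : Set (MvPolynomial σ K), (∀ f ∈ B, ∃ a b, f = binom K a b) ∧ I = Ideal.span B

theorem binom_self_mem (I : Ideal (MvPolynomial σ K)) (u : σ →₀ ℕ) : binom K u u ∈ I := by
  simp [binom]

theorem binom_symm {I : Ideal (MvPolynomial σ K)} {u v : σ →₀ ℕ} (h : binom K u v ∈ I) :
    binom K v u ∈ I := by
  simpa [binom] using I.neg_mem h

theorem binom_trans {I : Ideal (MvPolynomial σ K)} {u v w : σ →₀ ℕ} (h : binom K u v ∈ I)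
    (h' : binom K v w ∈ I) : binom K u w ∈ I := by
  simpa [binom] using I.add_mem h h'

theorem monomial_mul_binom (d : σ →₀ ℕ) (c : K) (u v : σ →₀ ℕ) :
    monomial d c * binom K u v = monomial (d + u) c - monomial (d + v) c := by
  simp [binom, mul_sub, monomial_mul]

theorem binom_add_left {I : Ideal (MvPolynomial σ K)} {u v : σ →₀ ℕ} (d : σ →₀ ℕ)
    (h : binom K u v ∈ I) : binom K (d + u) (d + v) ∈ I := by
  have := I.mul_mem_left (monomial d 1) h
  rwa [monomial_mul_binom] at this

/-- The sum of the coefficients of the monomials with exponent in `S`. -/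
def coeffSum (K : Type*) [Field K] (S : Set (σ →₀ ℕ)) : MvPolynomial σ K →ₗ[K] K :=
  (basisMonomials σ K).constr K (S.indicator 1)

theorem coeffSum_monomial (S : Set (σ →₀ ℕ)) (v : σ →₀ ℕ) (c : K) :
    coeffSum K S (monomial v c) = c * S.indicator 1 v := by
  have h : monomial v c = c • basisMonomials σ K v := by simp [smul_monomial]
  rw [h, map_smul, coeffSum, Module.Basis.constr_basis, smul_eq_mul]

/-- A monomial multiple of a generator is a difference of two congruent monomials. Either both lie
in the class of `u` and cancel, or neither does. -/
theorem IsBinomialIdeal.coeffSum_eq_zero {I : Ideal (MvPolynomial σ K)} (hI : IsBinomialIdeal I)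
    (u : σ →₀ ℕ) {f : MvPolynomial σ K} (hf : f ∈ I) :
    coeffSum K {v | binom K u v ∈ I} f = 0 := by
  obtain ⟨B, hB, hIB⟩ := hI
  -- `coeffSum` is only `K`-linear, so the induction over the ideal has to carry all multiples of
  -- `f`.
  suffices h : ∀ g : MvPolynomial σ K, coeffSum K {v | binom K u v ∈ I} (g * f) = 0 by
    simpa using h 1
  have hf' : f ∈ Submodule.span (MvPolynomial σ K) B := by rw [hIB] at hf; exact hf
  refine Submodule.span_induction
    (p := fun f _ => ∀ g : MvPolynomial σ K, coeffSum K {v | binom K u v ∈ I} (g * f) = 0)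
    ?_ ?_ ?_ ?_ hf'
  · intro f hfB g
    obtain ⟨a, b, rfl⟩ := hB f hfB
    have hab : binom K a b ∈ I := by rw [hIB]; exact Ideal.subset_span hfB
    induction g using MvPolynomial.induction_on' with
    | monomial d c =>
      have hiff : binom K u (d + a) ∈ I ↔ binom K u (d + b) ∈ I :=
        ⟨fun h => binom_trans h (binom_add_left d hab),
          fun h => binom_trans h (binom_symm (binom_add_left d hab))⟩
      rw [monomial_mul_binom, map_sub, coeffSum_monomial, coeffSum_monomial, sub_eq_zero]
      by_cases h : binom K u (d + a) ∈ I
      · rw [Set.indicator_of_mem (by exact h), Set.indicator_of_mem (by exact hiff.1 h)]; rfl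
      · rw [Set.indicator_of_notMem (by exact h),
          Set.indicator_of_notMem (by exact fun h' => h (hiff.2 h'))]
    | add p q hp hq => rw [add_mul, map_add, hp, hq, add_zero]
  · simp
  · intro x y _ _ hx hy g
    rw [mul_add, map_add, hx, hy, add_zero]
  · intro a x _ hx g
    rw [smul_eq_mul, ← mul_assoc, hx]

/-- Each monomial of an element of a binomial ideal is congruent to another one of its monomials. -/
theorem IsBinomialIdeal.exists_binom_mem {I : Ideal (MvPolynomial σ K)} (hI : IsBinomialIdeal I)
    {f : MvPolynomial σ K} (hf : f ∈ I) {u : σ →₀ ℕ} (hu : u ∈ f.support) :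
    ∃ v ∈ f.support, v ≠ u ∧ binom K u v ∈ I := by
  by_contra! hcon
  have h0 := hI.coeffSum_eq_zero u hf
  rw [f.as_sum, map_sum, Finset.sum_eq_single u] at h0
  · rw [coeffSum_monomial, Set.indicator_of_mem (by exact binom_self_mem I u)] at h0
    exact mem_support_iff.1 hu (by simpa using h0)
  · intro v hv hvu
    rw [coeffSum_monomial, Set.indicator_of_notMem (by exact hcon v hv hvu), mul_zero]
  · exact fun h => absurd hu h

/-- The exponents that are congruent modulo `I` to a smaller exponent. -/
def nonstandard (m : MonomialOrder σ) (I : Ideal (MvPolynomial σ K)) : Set (σ →₀ ℕ) :=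
  {u | ∃ v, binom K u v ∈ I ∧ m.toSyn v < m.toSyn u}

variable {m : MonomialOrder σ} {I : Ideal (MvPolynomial σ K)}

theorem nonstandard_of_le {u v : σ →₀ ℕ} (huv : u ≤ v) (hu : u ∈ nonstandard m I) :
    v ∈ nonstandard m I := by
  obtain ⟨w, hw, hlt⟩ := hu
  refine ⟨(v - u) + w, ?_, ?_⟩
  · have := binom_add_left (v - u) hw
    rwa [tsub_add_cancel_of_le huv] at this
  · conv_rhs => rw [← tsub_add_cancel_of_le huv]
    rw [map_add, map_add]
    gcongr

theorem eq_of_binom_mem_of_notMem_nonstandard {u v : σ →₀ ℕ} (huv : binom K u v ∈ I)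
    (hu : u ∉ nonstandard m I) (hv : v ∉ nonstandard m I) : u = v := by
  by_contra hne
  rcases lt_or_gt_of_ne (m.toSyn.injective.ne hne) with h | h
  · exact hv ⟨u, binom_symm huv, h⟩
  · exact hu ⟨v, huv, h⟩

theorem exists_binom_mem_notMem_nonstandard (m : MonomialOrder σ) (I : Ideal (MvPolynomial σ K))
    (u : σ →₀ ℕ) : ∃ v, binom K u v ∈ I ∧ v ∉ nonstandard m I := by
  obtain ⟨v, hv, hmin⟩ := (InvImage.wf m.toSyn (wellFounded_lt (α := m.syn))).has_min
    {v | binom K u v ∈ I} ⟨u, binom_self_mem I u⟩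
  exact ⟨v, hv, fun ⟨w, hw, hlt⟩ => hmin w (binom_trans hv hw) hlt⟩

theorem support_binom {u v : σ →₀ ℕ} {d : σ →₀ ℕ} (hd : d ∈ (binom K u v).support) :
    d = u ∨ d = v := by
  classical
  have := support_sub σ _ _ hd
  rw [Finset.mem_union] at this
  exact this.imp (fun h => Finset.mem_singleton.1 (support_monomial_subset h))
    fun h => Finset.mem_singleton.1 (support_monomial_subset h)

theorem left_mem_support_binom {u v : σ →₀ ℕ} (h : u ≠ v) : u ∈ (binom K u v).support := by
  classical
  simp [binom, coeff_monomial, h.symm]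

theorem right_mem_support_binom {u v : σ →₀ ℕ} (h : u ≠ v) : v ∈ (binom K u v).support := by
  classical
  simp [binom, coeff_monomial, h]

theorem degree_binom {u v : σ →₀ ℕ} (h : m.toSyn v < m.toSyn u) :
    m.degree (binom K u v) = u := by
  classical
  rw [binom, m.degree_sub_of_lt] <;> simp [m.degree_monomial, h]

theorem monic_binom {u v : σ →₀ ℕ} (h : m.toSyn v < m.toSyn u) : m.Monic (binom K u v) := by
  classical
  have hne : v ≠ u := fun e => h.ne (by rw [e])
  rw [MonomialOrder.Monic, MonomialOrder.leadingCoeff, degree_binom h]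
  simp [binom, coeff_monomial, hne]

theorem leadingTerm_of_monic {f : MvPolynomial σ K} (hf : m.Monic f) :
    m.leadingTerm f = monomial (m.degree f) 1 := by
  rw [MonomialOrder.leadingTerm, hf.leadingCoeff_eq_one]

/-- The leading monomial is congruent to another monomial of `f`, which is necessarily smaller. -/
theorem IsBinomialIdeal.degree_mem_nonstandard (hI : IsBinomialIdeal I) {f : MvPolynomial σ K}
    (hf : f ∈ I) (h0 : f ≠ 0) : m.degree f ∈ nonstandard m I := by
  obtain ⟨v, hv, hne, hb⟩ := hI.exists_binom_mem hf (m.degree_mem_support h0)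
  exact ⟨v, hb, lt_of_le_of_ne (m.le_degree hv) (m.toSyn.injective.ne hne)⟩

theorem IsBinomialIdeal.span_leadingTerm (hI : IsBinomialIdeal I) :
    Ideal.span (m.leadingTerm '' (I : Set (MvPolynomial σ K))) =
      Ideal.span ((fun s => monomial s (1 : K)) '' nonstandard m I) := by
  apply le_antisymm <;> rw [Ideal.span_le]
  · rintro _ ⟨f, hf, rfl⟩
    by_cases h0 : f = 0
    · simp [h0]
    · rw [SetLike.mem_coe, mem_ideal_span_monomial_image]
      intro d hd
      rw [MonomialOrder.leadingTerm] at hd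
      rw [Finset.mem_singleton.1 (support_monomial_subset hd)]
      exact ⟨_, hI.degree_mem_nonstandard hf h0, le_rfl⟩
  · rintro _ ⟨u, ⟨v, hv, hlt⟩, rfl⟩
    refine Ideal.subset_span ⟨binom K u v, hv, ?_⟩
    rw [leadingTerm_of_monic (monic_binom hlt), degree_binom hlt]

/-- A binomial whose leading exponent is a minimal nonstandard one and whose other exponent is
standard belongs to the reduced Gröbner basis. -/
theorem IsBinomialIdeal.binom_mem_reducedGroebnerBasis [Finite σ] (hI : IsBinomialIdeal I)
    {u v : σ →₀ ℕ} (huv : binom K u v ∈ I) (hu : Minimal (· ∈ nonstandard m I) u)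
    (hv : v ∉ nonstandard m I) : binom K u v ∈ reducedGroebnerBasis m I := by
  -- `nf` is the normal form on exponents. The reduced basis consists of `x^w - x^(nf w)` for `w`
  -- minimal nonstandard.
  choose nf hnf hstd using exists_binom_mem_notMem_nonstandard m I
  have hlt : ∀ w ∈ nonstandard m I, m.toSyn (nf w) < m.toSyn w := by
    intro w hw
    by_contra! hle
    rcases hle.lt_or_eq with h | h
    · exact hstd w ⟨w, binom_symm (hnf w), h⟩
    · exact hstd w (m.toSyn.injective h ▸ hw)
  refine ⟨(fun w => binom K w (nf w)) '' {w | Minimal (· ∈ nonstandard m I) w},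
    ⟨(finite_minimal _).image _, ?_, ?_, ?_, ?_⟩, u, hu, ?_⟩
  · rintro _ ⟨w, -, rfl⟩
    exact hnf w
  · rw [hI.span_leadingTerm]
    have himg : m.leadingTerm '' ((fun w => binom K w (nf w)) ''
        {w | Minimal (· ∈ nonstandard m I) w}) =
        (fun s => monomial s (1 : K)) '' {w | Minimal (· ∈ nonstandard m I) w} := by
      rw [Set.image_image]
      refine Set.image_congr fun w hw => ?_
      rw [leadingTerm_of_monic (monic_binom (hlt w hw.prop)), degree_binom (hlt w hw.prop)]
    rw [himg]
    refine le_antisymm (Ideal.span_mono (Set.image_mono fun w hw => hw.prop)) ?_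
    rw [Ideal.span_le]
    rintro _ ⟨w, hw, rfl⟩
    rw [SetLike.mem_coe, mem_ideal_span_monomial_image]
    intro d hd
    rw [Finset.mem_singleton.1 (support_monomial_subset hd)]
    obtain ⟨w', hle, hmin⟩ := exists_minimal_le _ hw
    exact ⟨w', hmin, hle⟩
  · rintro _ ⟨w, hw, rfl⟩
    exact monic_binom (hlt w hw.prop)
  · rintro _ ⟨w, hw, rfl⟩ _ ⟨w', hw', rfl⟩ hne d hd hle
    rw [degree_binom (hlt w' hw'.prop)] at hle
    rcases support_binom hd with rfl | rfl
    · exact hne (by rw [hw.eq_of_le hw'.prop hle])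
    · exact hstd w (nonstandard_of_le hle hw'.prop)
  · have : nf u = v :=
      eq_of_binom_mem_of_notMem_nonstandard (binom_trans (binom_symm (hnf u)) huv) (hstd u) hv
    simp only [this]

/-- The two exponents of an element of the reduced Gröbner basis that is a binomial. -/
theorem IsBinomialIdeal.minimal_nonstandard (hI : IsBinomialIdeal I)
    {u v : σ →₀ ℕ} (h : binom K u v ∈ reducedGroebnerBasis m I) (hlt : m.toSyn v < m.toSyn u) :
    Minimal (· ∈ nonstandard m I) u ∧ v ∉ nonstandard m I := by
  obtain ⟨G, hG, hmem⟩ := h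
  have hne : u ≠ v := fun e => hlt.ne (by rw [e])
  have hdiv : ∀ w ∈ nonstandard m I, ∃ g ∈ G, m.degree g ≤ w := by
    intro w hw
    have h1 : monomial w (1 : K) ∈ Ideal.span (m.leadingTerm '' G) := by
      rw [hG.span_leadingTerm, hI.span_leadingTerm]
      exact Ideal.subset_span ⟨w, hw, rfl⟩
    have himg : m.leadingTerm '' G = (fun s => monomial s (1 : K)) '' (m.degree '' G) := by
      rw [Set.image_image]
      exact Set.image_congr fun g hg => leadingTerm_of_monic (hG.monic g hg)
    rw [himg, mem_ideal_span_monomial_image] at h1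
    obtain ⟨_, ⟨g, hg, rfl⟩, hle⟩ := h1 w (by classical simp [support_monomial])
    exact ⟨g, hg, hle⟩
  refine ⟨⟨⟨v, hG.subset hmem, hlt⟩, fun w hw hwu => ?_⟩, fun hv => ?_⟩
  · obtain ⟨g, hg, hle⟩ := hdiv w hw
    by_cases hgu : g = binom K u v
    · rwa [hgu, degree_binom hlt] at hle
    · exact absurd (hle.trans hwu) (hG.reduced _ hmem g hg hgu u (left_mem_support_binom hne))
  · obtain ⟨g, hg, hle⟩ := hdiv v hv
    by_cases hgu : g = binom K u v
    · rw [hgu, degree_binom hlt] at hle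
      exact absurd (m.toSyn_monotone hle) (not_le.2 hlt)
    · exact hG.reduced _ hmem g hg hgu v (right_mem_support_binom hne) hle

end BinomialIdeal

end CodeIdeal

end

noncomputable section

namespace CodeIdeal

/-! ### Separating weights and the exchange of the two exponents -/

section Separating

theorem binom_mem_of_add_single {σ K : Type*} [Field K]
    {I : Ideal (MvPolynomial σ K)} {i : σ} (hi : ∃ g, X i * g - 1 ∈ I) {p q : σ →₀ ℕ}
    (h : binom K (Finsupp.single i 1 + p) (Finsupp.single i 1 + q) ∈ I) : binom K p q ∈ I := by
  obtain ⟨g, hg⟩ := hi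
  have h' : X i * binom K p q ∈ I := by
    rw [X, monomial_mul_binom]
    exact h
  have := I.sub_mem (I.mul_mem_left g h') (I.mul_mem_left (binom K p q) hg)
  convert this using 1
  ring

variable {σ : Type*} [Fintype σ] {K : Type*} [Field K] {I : Ideal (MvPolynomial σ K)}

/-- In the fibre of `a`, the exponent `b` is the only one of least weight, and `a` is lighter than
every other exponent that shares a variable with `a`. -/
structure IsSeparating (ω : σ → ℝ≥0) (I : Ideal (MvPolynomial σ K)) (a b : σ →₀ ℕ) : Prop where
  lt : weight ω b < weight ω a
  left_lt : ∀ v, binom K a v ∈ I → v ≠ a → (∃ i, v i ≠ 0 ∧ a i ≠ 0) → weight ω a < weight ω v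
  right_lt : ∀ v, binom K a v ∈ I → v ≠ b → weight ω b < weight ω v

theorem weight_le_of_weightedOrder_lt {m : MonomialOrder σ} {ω : σ → ℝ≥0} {a b : σ →₀ ℕ}
    (h : (weightedOrder m ω).toSyn b < (weightedOrder m ω).toSyn a) :
    weight ω b ≤ weight ω a := by
  rcases (weightedOrder_lt_iff m ω a b).1 h with h | ⟨h, -⟩
  · exact h.le
  · exact h.ge

/-- If a proper divisor `w` of `a` reduced to `w'`, then `a - w + w'` would be in the fibre, share a
variable with `a`, and be no heavier than `a`. So `a` is minimal nonstandard; `b` is standard as the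
strictly lightest exponent of the fibre. -/
theorem IsSeparating.mem_cone (hI : IsBinomialIdeal I) {ω : σ → ℝ≥0} {a b : σ →₀ ℕ}
    (hab : binom K a b ∈ I) (h : IsSeparating ω I a b) (m : MonomialOrder σ) :
    ω ∈ cone m I a b := by
  have hlt := (weightedOrder_lt_iff m ω a b).2 (Or.inl h.lt)
  refine ⟨h.lt, hI.binom_mem_reducedGroebnerBasis hab ⟨⟨b, hab, hlt⟩, fun w hw hle => ?_⟩ ?_⟩
  · obtain ⟨w', hww', hw'⟩ := hw
    by_contra hcon
    have hadd : a - w + w = a := tsub_add_cancel_of_le hle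
    have hmem : binom K a (a - w + w') ∈ I := by
      have := binom_add_left (a - w) hww'
      rwa [hadd] at this
    have hne : a - w + w' ≠ a := by
      intro e
      rw [← hadd, add_tsub_cancel_right, add_right_inj] at e
      exact hw'.ne (by rw [e])
    obtain ⟨i, hi⟩ : ∃ i, w i < a i := by
      by_contra! hall
      exact hcon fun i => hall i
    have hsh : ∃ i, (a - w + w') i ≠ 0 ∧ a i ≠ 0 := by
      refine ⟨i, ?_, by omega⟩
      rw [Finsupp.add_apply, Finsupp.tsub_apply]
      omega
    have h1 := h.left_lt _ hmem hne hsh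
    rw [← hadd, weight_add, add_tsub_cancel_right, weight_add] at h1
    exact absurd (weight_le_of_weightedOrder_lt hw') (not_le.2 (lt_of_add_lt_add_left h1))
  · rintro ⟨v, hv, hvb⟩
    exact absurd (weight_le_of_weightedOrder_lt hvb)
      (not_le.2 (h.right_lt v (binom_trans hab hv) fun e => hvb.ne (by rw [e])))

/-- A monomial order for which `x ^ a - x ^ b` is in the reduced Gröbner basis yields a separating
weight, provided that the variables of `x ^ a` are invertible modulo `I`. -/
theorem exists_isSeparating {σ : Type} [Fintype σ] {I : Ideal (MvPolynomial σ K)}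
    {m : MonomialOrder σ} {a b : σ →₀ ℕ} (hab : m.toSyn b < m.toSyn a)
    (ha : Minimal (· ∈ nonstandard m I) a) (hb : b ∉ nonstandard m I) (hmem : binom K a b ∈ I)
    (hinv : ∀ i, a i ≠ 0 → ∃ g, X i * g - 1 ∈ I) :
    ∃ ω : σ → ℝ≥0, (∀ i, 0 < ω i) ∧ IsSeparating ω I a b := by
  let S₁ : Set (σ →₀ ℕ) := {v | binom K a v ∈ I ∧ v ≠ a ∧ ∃ i, v i ≠ 0 ∧ a i ≠ 0}
  let S₂ : Set (σ →₀ ℕ) := {v | binom K a v ∈ I ∧ v ≠ b}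
  have h₁ : ∀ v ∈ S₁, m.toSyn a < m.toSyn v := by
    rintro v ⟨hv, hva, i, hvi, hai⟩
    have hle : ∀ w : σ →₀ ℕ, w i ≠ 0 → Finsupp.single i 1 ≤ w := fun w hw =>
      Finsupp.single_le_iff.2 (Nat.one_le_iff_ne_zero.2 hw)
    -- Cancel the shared variable: `a'` is standard by minimality of `a`, and it is congruent to
    -- `v'`, so it is the smaller of the two.
    obtain ⟨a', rfl⟩ := exists_add_of_le (hle a hai)
    obtain ⟨v', rfl⟩ := exists_add_of_le (hle v hvi)
    have hv' := binom_mem_of_add_single (hinv i hai) hv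
    have ha' : a' ∉ nonstandard m I := by
      intro hN
      have := ha.le_of_le hN le_add_self i
      simp at this
    rw [map_add, map_add]
    refine add_lt_add_right (lt_of_le_of_ne ?_ ?_) _
    · by_contra! hlt
      exact ha' ⟨v', hv', hlt⟩
    · intro e
      exact hva (by rw [m.toSyn.injective e])
  have h₂ : ∀ v ∈ S₂, m.toSyn b < m.toSyn v := by
    rintro v ⟨hv, hvb⟩
    refine lt_of_le_of_ne ?_ fun e => hvb (m.toSyn.injective e).symm
    by_contra! hlt
    exact hb ⟨v, binom_trans (binom_symm hmem) hv, hlt⟩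
  -- Minimal elements suffice, because weights are monotone in the exponent.
  let P₁ : Set ((σ →₀ ℕ) × (σ →₀ ℕ)) := Prod.mk a '' {v | Minimal (· ∈ S₁) v}
  let P₂ : Set ((σ →₀ ℕ) × (σ →₀ ℕ)) := Prod.mk b '' {v | Minimal (· ∈ S₂) v}
  have hfin : (insert (b, a) (P₁ ∪ P₂)).Finite :=
    (((finite_minimal S₁).image _).union ((finite_minimal S₂).image _)).insert _
  have hlt : ∀ p ∈ insert (b, a) (P₁ ∪ P₂), m.toSyn p.1 < m.toSyn p.2 := by
    intro p hp
    rcases Set.mem_insert_iff.1 hp with hp | hp | hp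
    · rw [hp]
      exact hab
    · obtain ⟨v, hv, hvp⟩ := hp
      rw [← hvp]
      exact h₁ v hv.prop
    · obtain ⟨v, hv, hvp⟩ := hp
      rw [← hvp]
      exact h₂ v hv.prop
  obtain ⟨ω, hω, hP⟩ := exists_weight_of_finite m _ hfin hlt
  have hP₀ : weight ω b < weight ω a := hP (b, a) (Set.mem_insert _ _)
  have hP₁ : ∀ w, Minimal (· ∈ S₁) w → weight ω a < weight ω w := fun w hw =>
    hP (a, w) (Set.mem_insert_of_mem _ (Set.mem_union_left _ (Set.mem_image_of_mem _ hw)))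
  have hP₂ : ∀ w, Minimal (· ∈ S₂) w → weight ω b < weight ω w := fun w hw =>
    hP (b, w) (Set.mem_insert_of_mem _ (Set.mem_union_right _ (Set.mem_image_of_mem _ hw)))
  refine ⟨ω, hω, hP₀, fun v hv hva hsh => ?_, fun v hv hvb => ?_⟩
  · obtain ⟨w, hwv, hw⟩ := exists_minimal_le S₁ (v := v) ⟨hv, hva, hsh⟩
    exact (hP₁ w hw).trans_le (weight_mono ω hwv)
  · obtain ⟨w, hwv, hw⟩ := exists_minimal_le S₂ (v := v) ⟨hv, hvb⟩
    exact (hP₂ w hw).trans_le (weight_mono ω hwv)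

/-- Scale the weights of the variables of `a` by `τ`. -/
def scaleWeight (a : σ →₀ ℕ) (ω : σ → ℝ≥0) (τ : ℝ≥0) : σ → ℝ≥0 :=
  fun i => if a i = 0 then ω i else τ * ω i

theorem weight_scaleWeight (a : σ →₀ ℕ) (ω : σ → ℝ≥0) (τ : ℝ≥0) (v : σ →₀ ℕ) :
    weight (scaleWeight a ω τ) v =
      τ * weight (fun i => if a i = 0 then 0 else ω i) v +
        weight (fun i => if a i = 0 then ω i else 0) v := by
  simp only [weight, scaleWeight, Finset.mul_sum, ← Finset.sum_add_distrib]
  refine Finset.sum_congr rfl fun i _ => ?_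
  split_ifs <;> ring

theorem weight_congr {ω ω' : σ → ℝ≥0} {v : σ →₀ ℕ} (h : ∀ i, v i ≠ 0 → ω i = ω' i) :
    weight ω v = weight ω' v := by
  refine Finset.sum_congr rfl fun i _ => ?_
  by_cases hv : v i = 0
  · simp [hv]
  · rw [h i hv]

/-- Scaling down the weights of the variables of `a` exchanges the roles of `a` and `b`. -/
theorem IsSeparating.exists_swap {ω : σ → ℝ≥0} {a b : σ →₀ ℕ} (h : IsSeparating ω I a b)
    (hω : ∀ i, 0 < ω i) (hab : binom K a b ∈ I) (hdisj : ∀ i, a i ≠ 0 → b i = 0) (hb : b ≠ 0) :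
    ∃ ω', IsSeparating ω' I b a := by
  have hWb := weight_pos hω hb
  have hWa := hWb.trans h.lt
  have hsa : ∀ τ, weight (scaleWeight a ω τ) a = τ * weight ω a := by
    intro τ
    have h0 : weight (fun i => if a i = 0 then ω i else 0) a = 0 := by
      rw [weight_congr (ω' := 0) fun i hi => by simp [hi]]
      simp [weight]
    rw [weight_scaleWeight, h0, add_zero]
    congr 1
    exact weight_congr fun i hi => by simp [hi]
  have hsdisj : ∀ τ v, (∀ i, v i ≠ 0 → a i = 0) → weight (scaleWeight a ω τ) v = weight ω v :=
    fun τ v hv => weight_congr fun i hi => by simp [scaleWeight, hv i hi]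
  have hsb : ∀ τ, weight (scaleWeight a ω τ) b = weight ω b := fun τ =>
    hsdisj τ b fun i hi => by
      by_contra hai
      exact hi (hdisj i hai)
  let S : Set (σ →₀ ℕ) := {v | binom K a v ∈ I ∧ v ≠ a ∧ v ≠ b}
  -- At this scale `a` and `b` have equal weight, and all other exponents of the fibre are still
  -- strictly heavier.
  obtain ⟨t, ht⟩ : ∃ t, t = weight ω b / weight ω a := ⟨_, rfl⟩
  have ht0 : 0 < t := ht ▸ div_pos hWb hWa
  have ht1 : t ≤ 1 := ht ▸ (div_le_one hWa).2 h.lt.le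
  have hta : t * weight ω a = weight ω b := by rw [ht, div_mul_cancel₀ _ hWa.ne']
  have hS : ∀ v ∈ S, weight ω b < weight (scaleWeight a ω t) v := by
    rintro v ⟨hv, hva, hvb⟩
    by_cases hsh : ∃ i, v i ≠ 0 ∧ a i ≠ 0
    · have hlt : t * weight ω a < t * weight ω v :=
        mul_lt_mul_of_pos_left (h.left_lt v hv hva hsh) ht0
      rw [hta] at hlt
      -- For `t ≤ 1`, each scaled coordinate is at least `t` times the original one.
      refine hlt.trans_le ?_
      rw [weight, Finset.mul_sum]
      refine Finset.sum_le_sum fun i _ => ?_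
      rw [← mul_assoc]
      gcongr
      unfold scaleWeight
      split_ifs
      · exact mul_le_of_le_one_left' ht1
      · exact le_rfl
    · push Not at hsh
      rw [hsdisj t v hsh]
      exact h.right_lt v hv hvb
  have hnhds : {τ : ℝ≥0 | ∀ v ∈ {v | Minimal (· ∈ S) v},
      weight ω b < weight (scaleWeight a ω τ) v} ∈ nhds t := by
    refine (Filter.eventually_all_finite (finite_minimal S)).2 fun v hv => ?_
    have hcont : Continuous fun τ => weight (scaleWeight a ω τ) v := by
      simp only [weight_scaleWeight]
      fun_prop
    exact hcont.continuousAt.eventually_const_lt (hS v hv.prop)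
  -- A scale slightly below `t` makes `a` lighter than `b` and, by continuity on finitely many
  -- minimal exponents, keeps the others above `b`.
  obtain ⟨l, hl, hsub⟩ := exists_Ioc_subset_of_mem_nhds hnhds ⟨0, ht0⟩
  obtain ⟨τ, hlτ, hτt⟩ := exists_between hl
  have hτS : ∀ v ∈ S, weight ω b < weight (scaleWeight a ω τ) v := by
    intro v hv
    obtain ⟨w, hwv, hw⟩ := exists_minimal_le S hv
    exact (hsub ⟨hlτ, hτt.le⟩ w hw).trans_le (weight_mono _ hwv)
  have hlt : weight (scaleWeight a ω τ) a < weight ω b := by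
    rw [hsa, ← hta]
    exact mul_lt_mul_of_pos_right hτt hWa
  refine ⟨scaleWeight a ω τ, by rwa [hsb], fun v hv hvb hsh => ?_, fun v hv hva => ?_⟩
  · rw [hsb]
    refine hτS v ⟨binom_trans hab hv, ?_, hvb⟩
    rintro rfl
    obtain ⟨i, hi, hi'⟩ := hsh
    exact hi' (hdisj i hi)
  · by_cases hvb : v = b
    · rwa [hvb, hsb]
    · exact hlt.trans (hτS v ⟨binom_trans hab hv, hva, hvb⟩)

/-- A binomial with disjoint exponents whose variables are invertible modulo `I` and which lies in
the universal Gröbner basis has a nonempty cone. -/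
theorem cone_nonempty_of_mem_universalGroebnerBasis {σ : Type} [Fintype σ]
    {I : Ideal (MvPolynomial σ K)} (hI : IsBinomialIdeal I) (m : MonomialOrder.{0, 0} σ)
    {u v : σ →₀ ℕ} (huv : IsPureBinomial I u v)
    (hinv : ∀ i, u i ≠ 0 ∨ v i ≠ 0 → ∃ g, X i * g - 1 ∈ I) (hu : u ≠ 0 ∨ (2 : K) ≠ 0)
    (h : binom K u v ∈ universalGroebnerBasis I) : (cone m I u v).Nonempty := by
  obtain ⟨m', hm'⟩ := Set.mem_iUnion.1 h
  obtain ⟨hmem, hne, hdisj⟩ := huv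
  have hdisj' : ∀ i, v i ≠ 0 → u i = 0 := by
    intro i hi
    by_contra hui
    exact Finset.disjoint_left.1 hdisj (Finsupp.mem_support_iff.2 hui)
      (Finsupp.mem_support_iff.2 hi)
  rcases lt_or_gt_of_ne (m'.toSyn.injective.ne hne) with hlt | hlt
  · have hsymm : binom K u v = -binom K v u := by simp [binom]
    -- The leading coefficient here is `-1`, yet basis elements are monic.
    have h2 : (2 : K) = 0 := by
      obtain ⟨G, hG, hmemG⟩ := hm'
      have h1 := (hG.monic _ hmemG).coeff_degree
      rw [hsymm, m'.degree_neg, degree_binom hlt, coeff_neg] at h1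
      have h1' : coeff v (binom K v u) = 1 := by
        have := (monic_binom (K := K) hlt).coeff_degree
        rwa [degree_binom hlt] at this
      rw [h1'] at h1
      linear_combination h1 * (-1)
    have hswap : binom K u v = binom K v u := by
      have hC : (2 : MvPolynomial σ K) = 0 := by
        rw [← map_ofNat (C : K →+* MvPolynomial σ K) 2, h2, map_zero]
      rw [hsymm]
      linear_combination (-binom K v u) * hC
    rw [hswap] at hm'
    obtain ⟨hmin, hstd⟩ := hI.minimal_nonstandard hm' hlt
    obtain ⟨ω, hω, hsep⟩ := exists_isSeparating hlt hmin hstd (binom_symm hmem)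
      fun i hi => hinv i (Or.inr hi)
    obtain ⟨ω', hω'⟩ := hsep.exists_swap hω (binom_symm hmem) hdisj'
      (hu.resolve_right (not_not.2 h2))
    exact ⟨ω', hω'.mem_cone hI hmem m⟩
  · obtain ⟨hmin, hstd⟩ := hI.minimal_nonstandard hm' hlt
    obtain ⟨ω, -, hsep⟩ := exists_isSeparating hlt hmin hstd hmem fun i hi => hinv i (Or.inl hi)
    exact ⟨ω, hsep.mem_cone hI hmem m⟩

end Separating

end CodeIdeal

end

noncomputable section

namespace CodeIdeal

/-! ### Invertible variables modulo the code ideal -/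

section CodeIdealLemmas

variable {K : Type*} [Field K] {F : Type*} [Field F] [Fintype F] {n : ℕ}

theorem isBinomialIdeal_codeIdeal (α : F) (C : Submodule F (Fin n → F)) :
    IsBinomialIdeal (codeIdeal K α C) := by
  refine ⟨_, ?_, rfl⟩
  rintro f ⟨a, b, -, hf⟩
  exact ⟨_, _, hf⟩

theorem isBinomialIdeal_additiveIdeal (α : F) : IsBinomialIdeal (additiveIdeal K n α) := by
  refine ⟨_, ?_, rfl⟩
  rintro f (⟨i, u, v, w, -, rfl⟩ | ⟨i, u, v, -, rfl⟩)
  · exact ⟨Finsupp.single (i, u) 1 + Finsupp.single (i, v) 1, Finsupp.single (i, w) 1,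
      by simp [binom, X, monomial_mul]⟩
  · exact ⟨Finsupp.single (i, u) 1 + Finsupp.single (i, v) 1, 0,
      by simp [binom, X, monomial_mul]⟩

theorem IsBinomialIdeal.sup {σ : Type*} {I J : Ideal (MvPolynomial σ K)} (hI : IsBinomialIdeal I)
    (hJ : IsBinomialIdeal J) : IsBinomialIdeal (I ⊔ J) := by
  obtain ⟨B, hB, rfl⟩ := hI
  obtain ⟨B', hB', rfl⟩ := hJ
  exact ⟨B ∪ B', fun f hf => hf.elim (hB f) (hB' f), (Ideal.span_union B B').symm⟩

theorem ne_zero_of_isPrimitiveRoot {α : F} (hα : IsPrimitiveRoot α (Fintype.card F - 1)) :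
    α ≠ 0 :=
  hα.ne_zero (Nat.sub_ne_zero_of_lt Fintype.one_lt_card)

/-- The variables in the support of the code are invertible modulo the code ideal. -/
theorem exists_mul_sub_one_mem_codeIdeal {α : F} (hα : α ≠ 0) {C : Submodule F (Fin n → F)}
    {ij : Var F n} {c : Fin n → F} (hc : c ∈ C) (hci : c ij.1 ≠ 0) :
    ∃ g, X ij * g - 1 ∈ codeIdeal K α C := by
  -- A rescaled codeword `b` whose crossing contains this variable; the generator for the pair `b,
  -- 0` is `x^▲b - 1`.
  obtain ⟨b, hb, hbi⟩ : ∃ b ∈ C, b ij.1 = α ^ ((ij.2 : ℕ) + 1) :=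
    ⟨(α ^ ((ij.2 : ℕ) + 1) / c ij.1) • c, C.smul_mem _ hc, by simp [hci]⟩
  have hle : Finsupp.single ij 1 ≤ crossing α b :=
    Finsupp.single_le_iff.2 (by simp [crossing, hbi])
  obtain ⟨d, hd⟩ := exists_add_of_le hle
  refine ⟨monomial d 1, Ideal.subset_span ⟨b, 0, by simpa using hb, ?_⟩⟩
  have h0 : crossing α (0 : Fin n → F) = 0 := by
    ext ij
    simp [crossing, (pow_ne_zero _ hα).symm]
  rw [h0, hd]
  simp [binom, X, monomial_mul]

/-- The two monomials of a binomial of the code ideal have the same degree in each variable outside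
the support of the code. -/
theorem apply_eq_of_binom_mem_codeIdeal {α : F} {C : Submodule F (Fin n → F)} {ij : Var F n}
    (hC : ∀ c ∈ C, c ij.1 = 0) {u v : Var F n →₀ ℕ} (h : binom K u v ∈ codeIdeal K α C) :
    u ij = v ij := by
  classical
  -- Setting all other variables to `1` kills the generators and records the exponent of this one.
  let φ : MvPolynomial (Var F n) K →ₐ[K] Polynomial K :=
    aeval fun kl => if kl = ij then Polynomial.X else 1
  have hφ : ∀ w : Var F n →₀ ℕ, φ (monomial w 1) = Polynomial.X ^ w ij := by
    intro w
    simp [φ, aeval_monomial, Finsupp.prod_fintype, ite_pow]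
  have hker : codeIdeal K α C ≤ RingHom.ker φ := by
    rw [codeIdeal, Ideal.span_le]
    rintro _ ⟨a, b, hab, rfl⟩
    have hab' : a ij.1 = b ij.1 := sub_eq_zero.1 (hC _ hab)
    have : crossing α a ij = crossing α b ij := by simp [crossing, hab']
    rw [SetLike.mem_coe, RingHom.mem_ker, binom, map_sub, hφ, hφ, this, sub_self]
  have := hker h
  rw [RingHom.mem_ker, binom, map_sub, hφ, hφ, sub_eq_zero] at this
  simpa using congrArg Polynomial.natDegree this

/-- All variables are invertible modulo the additive ideal. -/
theorem exists_mul_sub_one_mem_additiveIdeal {α : F}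
    (hα : IsPrimitiveRoot α (Fintype.card F - 1)) (ij : Var F n) :
    ∃ g, X ij * g - 1 ∈ additiveIdeal K n α := by
  have hpos : Fintype.card F - 1 ≠ 0 := Nat.sub_ne_zero_of_lt Fintype.one_lt_card
  have : NeZero (Fintype.card F - 1) := ⟨hpos⟩
  have hα0 := ne_zero_of_isPrimitiveRoot hα
  -- Dividing by `α` compensates for the shift: index `k` stands for `α ^ (k + 1)`, which must be
  -- the negative of `α ^ (ij.2 + 1)`.
  obtain ⟨k, hk, hk'⟩ := hα.eq_pow_of_pow_eq_one
    (FiniteField.pow_card_sub_one_eq_one (-α ^ ((ij.2 : ℕ) + 1) / α)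
      (div_ne_zero (neg_ne_zero.2 (pow_ne_zero _ hα0)) hα0))
  refine ⟨X (ij.1, ⟨k, hk⟩), Ideal.subset_span (Or.inr ⟨ij.1, ij.2, ⟨k, hk⟩, ?_, rfl⟩)⟩
  rw [pow_succ α k, hk', div_mul_cancel₀ _ hα0, add_neg_cancel]

/-- For the code ideal alone, a coordinate on which the code vanishes has variables of equal
exponent in both monomials, so coprimality excludes them from a pure binomial. Adding `I_q` makes
every variable invertible. -/
theorem exists_mul_sub_one_mem {α : F} (hα : IsPrimitiveRoot α (Fintype.card F - 1))
    {C : Submodule F (Fin n → F)} {I : Ideal (MvPolynomial (Var F n) K)}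
    (hI : I = codeIdeal K α C ∨ I = codeIdeal K α C ⊔ additiveIdeal K n α)
    {u v : Var F n →₀ ℕ} (huv : IsPureBinomial I u v) (ij : Var F n) (hij : u ij ≠ 0 ∨ v ij ≠ 0) :
    ∃ g, X ij * g - 1 ∈ I := by
  rcases hI with rfl | rfl
  · by_cases hC : ∀ c ∈ C, c ij.1 = 0
    · have heq := apply_eq_of_binom_mem_codeIdeal hC huv.1
      have hu : u ij ≠ 0 := hij.elim id fun h => heq ▸ h
      exact absurd (Finsupp.mem_support_iff.2 (heq ▸ hu))
        (Finset.disjoint_left.1 huv.2.2 (Finsupp.mem_support_iff.2 hu))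
    · push Not at hC
      obtain ⟨c, hc, hci⟩ := hC
      exact exists_mul_sub_one_mem_codeIdeal (ne_zero_of_isPrimitiveRoot hα) hc hci
  · obtain ⟨g, hg⟩ := exists_mul_sub_one_mem_additiveIdeal (K := K) hα ij
    exact ⟨g, Ideal.mem_sup_right hg⟩

end CodeIdealLemmas

end CodeIdeal

end

open CodeIdeal in
theorem mainTheorem7 {K : Type*} [Field K] {F : Type*} [Field F] [Fintype F] (n : ℕ)
    (α : F) (hα : IsPrimitiveRoot α (Fintype.card F - 1)) (C : Submodule F (Fin n → F))
    (I : Ideal (MvPolynomial (Var F n) K))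
    (hI : I = codeIdeal K α C ∨ I = codeIdeal K α C ⊔ additiveIdeal K n α)
    (m : MonomialOrder.{0, 0} (Var F n)) (u u' : Var F n →₀ ℕ)
    (hprim : IsPrimitive I u u') (hu : u ≠ 0 ∨ (2 : K) ≠ 0) :
    binom K u u' ∈ universalGroebnerBasis I ↔ (cone m I u u').Nonempty := by
  refine ⟨fun h => ?_, fun ⟨ω, _, hω⟩ => Set.mem_iUnion.2 ⟨weightedOrder m ω, hω⟩⟩
  have hbin : IsBinomialIdeal I := by
    rcases hI with rfl | rfl
    · exact isBinomialIdeal_codeIdeal α C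
    · exact (isBinomialIdeal_codeIdeal α C).sup (isBinomialIdeal_additiveIdeal α)
  exact cone_nonempty_of_mem_universalGroebnerBasis hbin m hprim.1
    (fun ij hij => exists_mul_sub_one_mem hα hI hprim.1 ij hij) hu h
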